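/- Let $p$ be a prime. For a finite group $G$ write $[x,G]=\{x^{-1}g^{-1}xg \mid g\in G\}$ for $x\in G$, and let $Z(G)$, $\Phi(G)$, $\gamma_2(G)$ and $d(G)$ denote the centre, the Frattini subgroup, the commutator subgroup and the minimal number of generators of $G$. Let $G$ be a finite $p$-group of nilpotency class $2$ that is Camina-type, i.e. $G$ is non-abelian and $[x,G]=\gamma_2(G)$ for all $x\in G\setminus\Phi(G)$. Then the following hold. (i) $d(G)$ is even and $d(G)\ge 2\,d(\gamma_2(G))$. (ii) $G/Z(G)$ is homocyclic, i.e. isomorphic to a direct product of finitely many cyclic groups of the same order. (iii) If $\gamma_2(G)$ is cyclic, then $G$ is isoclinic to a finite $p$-group $H$ that is a full central product of $2$-generator groups of nilpotency class $2$: there are $m\ge 1$ and subgroups $K_1,\dots,K_m$ of $H$ which generate $H$ and commute elementwise with each other, such that $Z(K_i)=Z(H)$ for every $i$, and each $K_i$ satisfies $d(K_i)=2$, has nilpotency class $2$ and satisfies $\gamma_2(K_i)=Z(K_i)$. Here groups $G$ and $H$ are isoclinic if there are isomorphisms $\phi\colon G/Z(G)\to H/Z(H)$ and $\theta\colon\gamma_2(G)\to\gamma_2(H)$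 such that $\theta(x^{-1}y^{-1}xy)=x'^{-1}y'^{-1}x'y'$ whenever $\phi(xZ(G))=x'Z(H)$ and $\phi(yZ(G))=y'Z(H)$. (iv) $G$ satisfies Hypothesis A, i.e. $|\operatorname{Aut}_c(G)|=|\gamma_2(G)|^{d(G)}$, where $\operatorname{Aut}_c(G)$ is the group of automorphisms $\alpha$ of $G$ such that $\alpha(x)$ is conjugate to $x$ for all $x\in G$. -/

import Mathlib

universe u

open scoped commutatorElement

/-- The commutator `[x, y] = x⁻¹ y⁻¹ x y`. -/
def rcomm {G : Type*} [Group G] (x y : G) : G := x⁻¹ * y⁻¹ * x * y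

theorem rcomm_mem_commutator {G : Type*} [Group G] (x y : G) : rcomm x y ∈ commutator G := by
  have h : rcomm x y = x⁻¹ * y⁻¹ * x⁻¹⁻¹ * y⁻¹⁻¹ := by simp [rcomm]
  rw [h, ← commutatorElement_def]
  exact Subgroup.commutator_mem_commutator (Subgroup.mem_top _) (Subgroup.mem_top _)

/-- The set `[x, G] = {[x, g] | g ∈ G}` (not the subgroup generated by it). -/
def commSet {G : Type*} [Group G] (x : G) : Set G := Set.range fun g : G => rcomm x g

/-- A non-abelian finite group is Camina-type if `[x, G] = γ₂(G)` for all `x` outside the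
Frattini subgroup. -/
structure IsCaminaType (G : Type*) [Group G] : Prop where
  finite : Finite G
  nonabelian : ∃ x y : G, x * y ≠ y * x
  commSet_eq : ∀ x : G, x ∉ frattini G → commSet x = (commutator G : Set G)

/-- `G` is a direct product of finitely many finite cyclic groups of the same order. -/
def IsHomocyclic (G : Type*) [Group G] : Prop :=
  ∃ n r : ℕ, 0 < n ∧ Nonempty (G ≃* (Fin r → Multiplicative (ZMod n)))

/-- The group of class-preserving automorphisms `α` of `G`: `α x` is conjugate to `x` for
every `x`. -/
def autC (G : Type*) [Group G] : Subgroup (MulAut G) where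
  carrier := {α | ∀ x : G, IsConj x (α x)}
  one_mem' := fun x => IsConj.refl x
  mul_mem' := fun {_ β} hα hβ x => (hβ x).trans (hα (β x))
  inv_mem' := fun {α} hα x => by
    have h := hα (α⁻¹ x)
    rw [MulAut.apply_inv_self] at h
    exact h.symm

/-- The equality `|Aut_c(G)| = |γ₂(G)| ^ d(G)` for a finite group `G`; here `Group.rank G` is
`d(G)`. -/
def HypothesisA (G : Type*) [Group G] [Finite G] : Prop :=
  Nat.card (autC G) = Nat.card (commutator G) ^ Group.rank G

/-- Isoclinism of groups: isomorphisms `G/Z(G) ≃ H/Z(H)` and `γ₂(G) ≃ γ₂(H)` compatible with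
the commutator maps `G/Z(G) × G/Z(G) → γ₂(G)` and `H/Z(H) × H/Z(H) → γ₂(H)`. -/
def Isoclinic (G H : Type*) [Group G] [Group H] : Prop :=
  ∃ (φ : G ⧸ Subgroup.center G ≃* H ⧸ Subgroup.center H) (θ : commutator G ≃* commutator H),
    ∀ (x y : G) (x' y' : H), φ (x : G ⧸ Subgroup.center G) = (x' : H ⧸ Subgroup.center H) →
      φ (y : G ⧸ Subgroup.center G) = (y' : H ⧸ Subgroup.center H) →
      θ ⟨rcomm x y, rcomm_mem_commutator x y⟩ = ⟨rcomm x' y', rcomm_mem_commutator x' y'⟩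

/-- `H` is the (internal) full central product of its subgroups `K i`: they commute
elementwise with each other, generate `H`, and their centres are all equal to the centre of
`H`, that is, the centres of the factors are amalgamated completely. -/
structure IsFullCentralProduct {H ι : Type*} [Group H] (K : ι → Subgroup H) : Prop where
  commute : ∀ i j, i ≠ j → ∀ x ∈ K i, ∀ y ∈ K j, x * y = y * x
  iSup_eq_top : ⨆ i, K i = ⊤
  map_center : ∀ i, (Subgroup.center (K i)).map (K i).subtype = Subgroup.center H

/-! In class 2 the commutator map is a nondegenerate alternating pairing `c` of the finite abelian
`p`-groups `A = G/Z(G)` and `W = γ₂(G)`. An element outside `p • A` is detected by a homomorphism to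
`ZMod p`, so its lifts lie outside `Φ(G)`, and the Camina condition makes `c a` surjective there.
All four claims rest on this pairing (`IsCaminaPairing`).

(ii) Every `a` outside `p • A` has order `n = exp W`, so all cyclic factors of `A` are `ZMod n`. As
`Z(G) ≤ Φ(G)`, their number `r` is `d(G)`.

(i) Reduce `c` mod `p` to an alternating matrix of linear forms over `𝔽_p` in `d(W)` variables. Its
determinant is homogeneous of degree `r`, is the square of a polynomial `Q`, and vanishes over `𝔽_p`
only at the origin, by surjectivity. Then `Q` has exactly one zero, and Chevalley–Warning gives
`d(W) ≤ deg Q = r/2`.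

(iii) If `W` is cyclic, it is `ZMod n`, a local ring, and `A` has a symplectic basis. The isoclinism
class depends only on the pairing, so `G` is isoclinic to a Heisenberg group, where each hyperbolic
pair gives one central factor.

(iv) Class-preserving automorphisms are the maps `x ↦ x * f x` with `f a ∈ c a (A)` for all `a`.
Every `f : A →+ W` qualifies: write `a = p ^ k • y` with `y` outside `p • A`. As `n • W = 0`, there
are `|W| ^ r` such `f`. -/

section Symplectic

/-! ### Symplectic bases over local rings and alternating determinants. -/

open IsLocalRing

/-- The families `x`, `y` satisfy the relations of a symplectic basis with respect to `B`. -/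
structure IsSymplecticFamily {R A : Type*} [CommRing R] [AddCommGroup A] [Module R A]
    (B : A →ₗ[R] A →ₗ[R] R) {m : ℕ} (x y : Fin m → A) : Prop where
  left_left : ∀ i j, B (x i) (x j) = 0
  right_right : ∀ i j, B (y i) (y j) = 0
  left_right : ∀ i j, B (x i) (y j) = if i = j then 1 else 0
  right_left : ∀ i j, B (y i) (x j) = if i = j then -1 else 0

/-- Split off a hyperbolic plane and pass to its orthogonal complement. The induction is on the size
of a spanning set, because the projection to the complement kills one generator; freeness of `A` is
thus a result and not an assumption. -/
theorem exists_isSymplecticFamily_of_card_le {R : Type*} [CommRing R] [IsLocalRing R] (k : ℕ) :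
    ∀ {A : Type*} [AddCommGroup A] [Module R A] (B : A →ₗ[R] A →ₗ[R] R), B.IsAlt →
      (∀ a, a ∉ maximalIdeal R • (⊤ : Submodule R A) → ∃ b, B a b = 1) →
      ∀ s : Finset A, s.card ≤ k → Submodule.span R (s : Set A) = ⊤ →
      ∃ (m : ℕ) (x y : Fin m → A), IsSymplecticFamily B x y ∧
        Submodule.span R (Set.range x ∪ Set.range y) = ⊤ := by
  classical
  induction k with
  | zero =>
    intro A _ _ B _ _ s hs hspan
    have : s = ∅ := by simpa using hs
    subst this
    refine ⟨0, Fin.elim0, Fin.elim0, ⟨fun i => i.elim0, fun i => i.elim0, fun i => i.elim0,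
      fun i => i.elim0⟩, ?_⟩
    simpa using hspan
  | succ k ih =>
    intro A _ _ B hB h s hs hspan
    by_cases hv : ∃ v ∈ s, v ∉ maximalIdeal R • (⊤ : Submodule R A)
    swap
    · push Not at hv
      -- All generators lie in `𝔪 • A`, so `A = 0` by Nakayama.
      have hle : (⊤ : Submodule R A) ≤ maximalIdeal R • ⊤ := by
        rw [← hspan, Submodule.span_le, hspan]
        exact hv
      have hbot : (⊤ : Submodule R A) = ⊥ :=
        Submodule.eq_bot_of_le_smul_of_le_jacobson_bot _ _ ⟨s, hspan⟩ hle
          (maximalIdeal_le_jacobson _)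
      refine ⟨0, Fin.elim0, Fin.elim0, ⟨fun i => i.elim0, fun i => i.elim0, fun i => i.elim0,
        fun i => i.elim0⟩, ?_⟩
      rw [hbot, eq_bot_iff, ← hbot]
      exact le_top
    obtain ⟨v, hvs, hv⟩ := hv
    obtain ⟨w, hw⟩ := h v hv
    have hwv : B w v = -1 := by rw [← hB.neg, hw]
    let P : Submodule R A := LinearMap.ker (B.flip v) ⊓ LinearMap.ker (B.flip w)
    have hP : ∀ u : A, u ∈ P ↔ B u v = 0 ∧ B u w = 0 := fun u => by simp [P]
    have hPv : ∀ u ∈ P, B v u = 0 := fun u hu => by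
      rw [← hB.neg, ((hP u).1 hu).1, neg_zero]
    have hPw : ∀ u ∈ P, B w u = 0 := fun u hu => by
      rw [← hB.neg, ((hP u).1 hu).2, neg_zero]
    -- The projection onto `P` along `v` and `w`; the signs come from `B v w = 1` and `B w v = -1`.
    let q : A →ₗ[R] A :=
      LinearMap.id - (B.flip w).smulRight v + (B.flip v).smulRight w
    have hq : ∀ u, q u = u - B u w • v + B u v • w := fun u => by simp [q]
    let π : A →ₗ[R] P := q.codRestrict P fun u => by
      rw [hP, hq]
      simp [hB.self_eq_zero, hw, hwv]
    have hπ : ∀ u, (π u : A) = u - B u w • v + B u v • w := hq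
    have hπP : ∀ u : P, π u = u := fun u => by
      apply Subtype.ext
      rw [hπ, ((hP u).1 u.2).1, ((hP u).1 u.2).2]
      simp
    have hπv : π v = 0 := by
      apply Subtype.ext
      rw [hπ, hw, hB.self_eq_zero]
      simp
    let B' : P →ₗ[R] P →ₗ[R] R := B.domRestrict₁₂ P P
    have hB'app : ∀ a b : P, B' a b = B a b := fun a b => rfl
    have hB' : B'.IsAlt := fun u => hB u
    have h' : ∀ a : P, a ∉ maximalIdeal R • (⊤ : Submodule R P) → ∃ b, B' a b = 1 := by
      intro a ha
      -- The map `π` fixes `a` and sends `𝔪 • A` into `𝔪 • P`, so `a` is outside `𝔪 • A` too.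
      obtain ⟨b, hb⟩ := h a fun hmem => ha <| by
        have := Submodule.mem_map_of_mem (f := π) hmem
        rw [Submodule.map_smul'', hπP] at this
        exact Submodule.smul_mono le_rfl le_top this
      refine ⟨π b, ?_⟩
      rw [hB'app, hπ]
      simp [((hP a).1 a.2).1, ((hP a).1 a.2).2, hb]
    have hspan' : Submodule.span R (((s.erase v).image π : Finset P) : Set P) = ⊤ := by
      have h1 : Submodule.map π (Submodule.span R (s : Set A)) = ⊤ := by
        rw [hspan, Submodule.map_top, LinearMap.range_eq_top]
        exact fun u => ⟨u, hπP u⟩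
      rw [← Finset.insert_erase hvs, Finset.coe_insert, Submodule.map_span, Set.image_insert_eq,
        hπv, Submodule.span_insert_zero] at h1
      rw [Finset.coe_image]
      exact h1
    obtain ⟨m, x, y, hxy, hxyspan⟩ := ih B' hB' h' _
      (Finset.card_image_le.trans (by rw [Finset.card_erase_of_mem hvs]; omega)) hspan'
    refine ⟨m + 1, Fin.cons v fun i => x i, Fin.cons w fun i => y i, ⟨?_, ?_, ?_, ?_⟩, ?_⟩
    · intro i j
      refine Fin.cases ?_ (fun i => ?_) i <;> refine Fin.cases ?_ (fun j => ?_) j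
      · simpa using hB v
      · simpa using hPv _ (x j).2
      · simpa using ((hP _).1 (x i).2).1
      · simpa [hB'app] using hxy.left_left i j
    · intro i j
      refine Fin.cases ?_ (fun i => ?_) i <;> refine Fin.cases ?_ (fun j => ?_) j
      · simpa using hB w
      · simpa using hPw _ (y j).2
      · simpa using ((hP _).1 (y i).2).2
      · simpa [hB'app] using hxy.right_right i j
    · intro i j
      refine Fin.cases ?_ (fun i => ?_) i <;> refine Fin.cases ?_ (fun j => ?_) j
      · simpa using hw
      · simpa [(Fin.succ_ne_zero _).symm] using hPv _ (y j).2
      · simpa [(Fin.succ_ne_zero _)] using ((hP _).1 (x i).2).2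
      · simpa [hB'app] using hxy.left_right i j
    · intro i j
      refine Fin.cases ?_ (fun i => ?_) i <;> refine Fin.cases ?_ (fun j => ?_) j
      · simpa using hwv
      · simpa [(Fin.succ_ne_zero _).symm] using hPw _ (x j).2
      · simpa [(Fin.succ_ne_zero _)] using ((hP _).1 (y i).2).1
      · simpa [hB'app] using hxy.right_left i j
    · rw [eq_top_iff]
      intro a _
      set S := Submodule.span R (Set.range (Fin.cons v fun i => (x i : A) : Fin (m + 1) → A) ∪
        Set.range (Fin.cons w fun i => (y i : A) : Fin (m + 1) → A)) with hS
      have hvS : v ∈ S := Submodule.subset_span (Or.inl ⟨0, rfl⟩)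
      have hwS : w ∈ S := Submodule.subset_span (Or.inr ⟨0, rfl⟩)
      have hPS : ⊤ ≤ S.comap P.subtype := by
        rw [← hxyspan, Submodule.span_le]
        rintro _ (⟨i, rfl⟩ | ⟨i, rfl⟩)
        · exact Submodule.subset_span (Or.inl ⟨i.succ, rfl⟩)
        · exact Submodule.subset_span (Or.inr ⟨i.succ, rfl⟩)
      have hπS : (π a : A) ∈ S := hPS (Submodule.mem_top (x := π a))
      have ha : a = π a + B a w • v - B a v • w := by rw [hπ]; abel
      rw [ha]
      exact S.sub_mem (S.add_mem hπS (S.smul_mem _ hvS)) (S.smul_mem _ hwS)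

/-- Pairing a linear relation with `y j` or `x j` isolates one coefficient up to sign. -/
theorem IsSymplecticFamily.linearIndependent {R A : Type*} [CommRing R] [AddCommGroup A]
    [Module R A] {B : A →ₗ[R] A →ₗ[R] R} {m : ℕ} {x y : Fin m → A}
    (h : IsSymplecticFamily B x y) : LinearIndependent R (Sum.elim x y) := by
  rw [Fintype.linearIndependent_iff]
  intro g hg
  rw [Fintype.sum_sum_type] at hg
  simp only [Sum.elim_inl, Sum.elim_inr] at hg
  rintro (j | j)
  · have := congrArg (fun a => B a (y j)) hg
    simpa [h.left_right, h.right_right] using this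
  · have := congrArg (fun a => B a (x j)) hg
    simpa [h.right_left, h.left_left] using this

/-- An alternating form over a local ring such that `B a` is surjective for all `a` outside
`𝔪 • A` admits a symplectic basis. -/
theorem exists_symplectic_basis {R A : Type*} [CommRing R] [IsLocalRing R] [AddCommGroup A]
    [Module R A] [Module.Finite R A] {B : A →ₗ[R] A →ₗ[R] R} (hB : B.IsAlt)
    (h : ∀ a, a ∉ maximalIdeal R • (⊤ : Submodule R A) → ∃ b, B a b = 1) :
    ∃ (m : ℕ) (b : Module.Basis (Fin m ⊕ Fin m) R A),
      IsSymplecticFamily B (fun i => b (Sum.inl i)) fun i => b (Sum.inr i) := by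
  obtain ⟨s, hs⟩ := Module.Finite.fg_top (R := R) (M := A)
  obtain ⟨m, x, y, hxy, hspan⟩ := exists_isSymplecticFamily_of_card_le _ B hB h s le_rfl hs
  refine ⟨m, Module.Basis.mk hxy.linearIndependent (by rw [Set.Sum.elim_range, hspan]), ?_⟩
  simpa using hxy

theorem Matrix.det_fromBlocks_zero_one_neg_one_zero {R l : Type*} [CommRing R] [Fintype l]
    [DecidableEq l] : (Matrix.fromBlocks 0 1 (-1) 0 : Matrix (l ⊕ l) (l ⊕ l) R).det = 1 := by
  have h : (Matrix.fromBlocks 0 1 (-1) 0 : Matrix (l ⊕ l) (l ⊕ l) R) =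
      Matrix.fromBlocks 1 1 0 1 * Matrix.fromBlocks 1 0 (-1) 1 * Matrix.fromBlocks 1 1 0 1 := by
    simp [Matrix.fromBlocks_multiply]
  rw [h, Matrix.det_mul, Matrix.det_mul]
  simp

/-- A nonsingular alternating matrix over a field has even size, and its determinant is a
square. -/
theorem Matrix.even_and_isSquare_det_of_alternating {K : Type*} [Field K] {r : ℕ}
    (A : Matrix (Fin r) (Fin r) K) (hdiag : ∀ i, A i i = 0) (hskew : ∀ i j, A i j = -A j i)
    (hdet : A.det ≠ 0) : Even r ∧ IsSquare A.det := by
  classical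
  let B : (Fin r → K) →ₗ[K] (Fin r → K) →ₗ[K] K := Matrix.toLinearMap₂' K A
  have hBapp : ∀ v w, B v w = v ⬝ᵥ A.mulVec w := fun v w => Matrix.toLinearMap₂'_apply' A v w
  have hB : B.IsAlt := by
    intro v
    rw [hBapp]
    simp only [dotProduct, Matrix.mulVec, Finset.mul_sum]
    rw [← Finset.sum_product']
    -- The terms at `(i, j)` and `(j, i)` cancel, and the diagonal ones vanish by `hdiag`; this
    -- covers characteristic 2.
    refine Finset.sum_involution (fun a _ => (a.2, a.1)) ?_ ?_ ?_ ?_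
    · intro a _
      simp only
      rw [hskew a.1 a.2]
      ring
    · rintro ⟨i, j⟩ _ hne heq
      simp only [Prod.mk.injEq] at heq
      obtain ⟨rfl, -⟩ := heq
      simp [hdiag] at hne
    · simp
    · simp
  have h : ∀ a, a ∉ maximalIdeal K • (⊤ : Submodule K (Fin r → K)) → ∃ b, B a b = 1 := by
    intro a ha
    have ha0 : a ≠ 0 := by
      rintro rfl
      exact ha (zero_mem _)
    have hne : ¬ ∀ b, B a b = 0 := by
      intro hall
      apply hdet
      rw [← Matrix.exists_vecMul_eq_zero_iff]
      refine ⟨a, ha0, ?_⟩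
      ext j
      have := hall (Pi.single j 1)
      rw [hBapp, Matrix.dotProduct_mulVec] at this
      simpa using this
    push Not at hne
    obtain ⟨b, hb⟩ := hne
    exact ⟨(B a b)⁻¹ • b, by simp [hb]⟩
  obtain ⟨m, b, hb⟩ := exists_symplectic_basis hB h
  let e : Fin r ≃ Fin m ⊕ Fin m := (Pi.basisFun K (Fin r)).indexEquiv b
  refine ⟨⟨m, by simpa using Fintype.card_congr e⟩, ?_⟩
  let P : Matrix (Fin r) (Fin r) K := Matrix.of fun i => b (e i)
  have hPA : P * A * P.transpose =
      (Matrix.fromBlocks 0 1 (-1) 0 : Matrix (Fin m ⊕ Fin m) (Fin m ⊕ Fin m) K).submatrix e e := by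
    ext i j
    have h1 : (P * A * P.transpose) i j = B (b (e i)) (b (e j)) := by
      rw [hBapp, Matrix.dotProduct_mulVec]
      rfl
    rw [h1, Matrix.submatrix_apply]
    rcases e i with k | k <;> rcases e j with l | l
    · simpa using hb.left_left k l
    · simpa [Matrix.one_apply] using hb.left_right k l
    · have := hb.right_left k l
      simp only [Matrix.fromBlocks_apply₂₁, Matrix.neg_apply, Matrix.one_apply, this]
      split_ifs <;> simp
    · simpa using hb.right_right k l
  -- Taking determinants gives `det P * det A * det P = 1`, so `(det P)⁻¹` is the square root.
  have hd := congrArg Matrix.det hPA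
  rw [Matrix.det_submatrix_equiv_self, Matrix.det_fromBlocks_zero_one_neg_one_zero,
    Matrix.det_mul, Matrix.det_mul, Matrix.det_transpose] at hd
  have hP0 : P.det ≠ 0 := by
    intro h0
    simp [h0] at hd
  refine ⟨P.det⁻¹, ?_⟩
  field_simp
  linear_combination hd

/-- Over an integrally closed domain, the determinant of an alternating matrix is a square. -/
theorem Matrix.exists_det_eq_mul_self_of_alternating {R : Type*} [CommRing R] [IsDomain R]
    [IsIntegrallyClosed R] {r : ℕ} (A : Matrix (Fin r) (Fin r) R) (hdiag : ∀ i, A i i = 0)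
    (hskew : ∀ i j, A i j = -A j i) (hdet : A.det ≠ 0) : Even r ∧ ∃ q, A.det = q * q := by
  let K := FractionRing R
  have hinj := IsFractionRing.injective R K
  have hmap : (A.map (algebraMap R K)).det = algebraMap R K A.det := by
    rw [RingHom.map_det]
    rfl
  obtain ⟨hr, q, hq⟩ := Matrix.even_and_isSquare_det_of_alternating (A.map (algebraMap R K))
    (fun i => by simp [hdiag]) (fun i j => by rw [Matrix.map_apply, hskew]; simp)
    (by rw [hmap]; exact (map_ne_zero_iff _ hinj).2 hdet)
  refine ⟨hr, ?_⟩
  rw [hmap] at hq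
  -- The root in the fraction field has its square in `R`, so it is integral and lies in `R`.
  obtain ⟨q', rfl⟩ := IsIntegrallyClosed.isIntegral_iff.1
    (show IsIntegral R q from .of_pow (n := 2) two_pos (by
      rw [pow_two, ← hq]; exact isIntegral_algebraMap))
  exact ⟨q', hinj (by rw [hq, map_mul])⟩

end Symplectic

/-! ### Finite abelian `p`-groups as products of `ZMod q`. -/

section ZModLemmas

theorem ZMod.exists_eq_nsmul_of_castHom_eq_zero {p q : ℕ} [NeZero q] (h : p ∣ q) {x : ZMod q}
    (hx : ZMod.castHom h (ZMod p) x = 0) : ∃ y : ZMod q, x = p • y := by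
  have hx' : ((x.val : ℕ) : ZMod p) = 0 := by
    rw [← ZMod.natCast_zmod_val x, map_natCast] at hx
    exact hx
  obtain ⟨k, hk⟩ := (ZMod.natCast_eq_zero_iff _ _).1 hx'
  refine ⟨k, ?_⟩
  rw [← ZMod.natCast_zmod_val x, hk]
  simp

theorem ZMod.castHom_nsmul_eq_zero {p q : ℕ} (h : p ∣ q) (y : ZMod q) :
    ZMod.castHom h (ZMod p) (p • y) = 0 := by
  rw [map_nsmul, nsmul_eq_mul, ZMod.natCast_self, zero_mul]

theorem ZMod.isLocalRing_prime_pow {p k : ℕ} [hp : Fact p.Prime] (hk : k ≠ 0) :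
    IsLocalRing (ZMod (p ^ k)) := by
  have : Nontrivial (ZMod (p ^ k)) :=
    ZMod.nontrivial_iff.2 (Nat.one_lt_pow hk hp.out.one_lt).ne'
  have : IsLocalHom (ZMod.castHom (dvd_pow_self p hk) (ZMod p)) := by
    refine ⟨fun x hx => ?_⟩
    rw [← ZMod.natCast_zmod_val x, map_natCast, ZMod.isUnit_iff_coprime] at hx
    rw [← ZMod.natCast_zmod_val x, ZMod.isUnit_iff_coprime]
    exact hx.pow_right k
  exact (ZMod.castHom (dvd_pow_self p hk) (ZMod p)).domain_isLocalRing

theorem exists_addEquiv_pi_zmod {p : ℕ} [hp : Fact p.Prime] (A : Type*) [AddCommGroup A] [Finite A]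
    (hA : ∀ a : A, ∃ k : ℕ, p ^ k • a = 0) :
    ∃ (ι : Type) (_ : Fintype ι) (q : ι → ℕ), (∀ i, 1 < q i ∧ p ∣ q i) ∧
      Nonempty (A ≃+ (∀ i, ZMod (q i))) := by
  classical
  obtain ⟨ι, _, q, hq, ⟨e⟩⟩ := CommGroup.equiv_prod_multiplicative_zmod_of_finite (Multiplicative A)
  let e' : A ≃+ (∀ i, ZMod (q i)) := MulEquiv.toAdditive e
  refine ⟨ι, inferInstance, q, fun i => ⟨hq i, ?_⟩, ⟨e'⟩⟩
  obtain ⟨k, hk⟩ := hA (e'.symm (Pi.single i 1))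
  have h1 := congrArg (fun a => e' a i) hk
  simp only [map_nsmul, AddEquiv.apply_symm_apply, Pi.smul_apply, Pi.single_eq_same, map_zero,
    Pi.zero_apply, nsmul_eq_mul, mul_one] at h1
  rw [ZMod.natCast_eq_zero_iff] at h1
  obtain ⟨j, -, hj⟩ := (Nat.dvd_prime_pow hp.out).1 h1
  rw [hj]
  refine dvd_pow_self p fun h0 => ?_
  have := hq i
  rw [hj, h0] at this
  simp at this

/-- Elements outside `p • A` are detected by homomorphisms to `ZMod p`. -/
theorem exists_addMonoidHom_zmod_ne_zero {p : ℕ} [hp : Fact p.Prime] {A : Type*} [AddCommGroup A]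
    [Finite A] (hA : ∀ a : A, ∃ k : ℕ, p ^ k • a = 0) {a : A} (ha : ∀ b, a ≠ p • b) :
    ∃ f : A →+ ZMod p, f a ≠ 0 := by
  obtain ⟨ι, _, q, hq, ⟨e⟩⟩ := exists_addEquiv_pi_zmod A hA
  by_contra! hall
  have : ∀ i, ∃ y : ZMod (q i), e a i = p • y := fun i => by
    have : NeZero (q i) := ⟨(zero_lt_one.trans (hq i).1).ne'⟩
    refine ZMod.exists_eq_nsmul_of_castHom_eq_zero (hq i).2 ?_
    exact hall ((ZMod.castHom (hq i).2 (ZMod p)).toAddMonoidHom.comp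
      ((Pi.evalAddMonoidHom _ i).comp e.toAddMonoidHom))
  choose y hy using this
  refine ha (e.symm y) (e.injective ?_)
  ext i
  simp [hy]

section StdGen

variable {A ι : Type*} [AddCommGroup A] [DecidableEq ι] {q : ι → ℕ} (e : A ≃+ (∀ i, ZMod (q i)))

/-- The generators of `A` corresponding to the standard basis. -/
def stdGen (j : ι) : A := e.symm (Pi.single j 1)

theorem sum_val_nsmul_stdGen [Fintype ι] [∀ i, NeZero (q i)] (a : A) :
    a = ∑ j, (e a j).val • stdGen e j := by
  apply e.injective
  rw [map_sum]
  ext i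
  simp only [stdGen, map_nsmul, AddEquiv.apply_symm_apply, Finset.sum_apply, Pi.smul_apply]
  rw [Finset.sum_eq_single i]
  · simp
  · intro j _ hj
    simp [Pi.single_eq_of_ne hj.symm]
  · simp

theorem closure_range_stdGen [Fintype ι] [∀ i, NeZero (q i)] :
    AddSubgroup.closure (Set.range (stdGen e)) = ⊤ := by
  rw [eq_top_iff]
  intro a _
  rw [sum_val_nsmul_stdGen e a]
  exact sum_mem fun j _ => nsmul_mem (AddSubgroup.subset_closure (Set.mem_range_self j)) _

end StdGen

/-- Since `n` kills `W`, the images of the `r` standard generators can be chosen freely. -/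
theorem natCard_addMonoidHom_of_addEquiv_pi_zmod {A : Type*} [AddCommGroup A] {r n : ℕ} [NeZero n]
    (e : A ≃+ (Fin r → ZMod n)) {W : Type*} [AddCommGroup W] (hW : ∀ w : W, n • w = 0) :
    Nat.card (A →+ W) = Nat.card W ^ r := by
  let Φ : (A →+ W) → (Fin r → W) := fun f j => f (stdGen e j)
  have hΦ : Function.Bijective Φ := by
    constructor
    · intro f g hfg
      ext a
      rw [sum_val_nsmul_stdGen e a, map_sum, map_sum]
      refine Finset.sum_congr rfl fun j _ => ?_
      rw [map_nsmul, map_nsmul]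
      exact congrArg _ (congrFun hfg j)
    · intro w
      let l : Fin r → (ZMod n →+ W) := fun j =>
        ZMod.lift n ⟨zmultiplesHom W (w j), by simpa using hW (w j)⟩
      refine ⟨∑ j, (l j).comp ((Pi.evalAddMonoidHom _ j).comp e.toAddMonoidHom), ?_⟩
      have hl : ∀ j, l j 1 = w j := fun j => by
        have := ZMod.lift_coe n (⟨zmultiplesHom W (w j), by simpa using hW (w j)⟩ :
          {f : ℤ →+ W // f n = 0}) 1
        simpa using this
      funext k
      simp only [Φ, stdGen, AddMonoidHom.finsetSum_apply, AddMonoidHom.comp_apply]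
      rw [Finset.sum_eq_single k]
      · simp [hl]
      · intro j _ hj
        simp [hj]
      · simp
  rw [Nat.card_eq_of_bijective Φ hΦ, Nat.card_fun, Nat.card_fin]

end ZModLemmas

/-! ### Camina pairings: structure of `A`, rank bound, symplectic normal form. -/

/-- An alternating nondegenerate pairing of abelian groups such that `c a` is surjective for all
`a` outside `p • A`. -/
structure IsCaminaPairing (p : ℕ) {A W : Type*} [AddCommGroup A] [AddCommGroup W]
    (c : A →+ A →+ W) : Prop where
  self_eq_zero : ∀ a, c a a = 0
  eq_zero : ∀ a, (∀ b, c a b = 0) → a = 0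
  surjective : ∀ a, (∀ b, a ≠ p • b) → Function.Surjective (c a)

namespace IsCaminaPairing

variable {p : ℕ} [hp : Fact p.Prime] {A W : Type*} [AddCommGroup A] [AddCommGroup W]
  {c : A →+ A →+ W}

theorem skew {p : ℕ} {A W : Type*} [AddCommGroup A] [AddCommGroup W]
    {c : A →+ A →+ W} (h : IsCaminaPairing p c) (a b : A) : c a b = -c b a := by
  have := h.self_eq_zero (a + b)
  simp only [map_add, AddMonoidHom.add_apply, h.self_eq_zero, zero_add, add_zero] at this
  exact eq_neg_of_add_eq_zero_right this

theorem exponent_nsmul_eq_zero {p : ℕ} {A W : Type*} [AddCommGroup A] [AddCommGroup W]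
    {c : A →+ A →+ W} (h : IsCaminaPairing p c) (a : A) : AddMonoid.exponent W • a = 0 :=
  h.eq_zero _ fun b => by
    rw [map_nsmul, AddMonoidHom.nsmul_apply, AddMonoid.exponent_nsmul_eq_zero]

/-- If `m • a = 0`, then `m` kills `c a (A)`, which is all of `W`; nondegeneracy gives the other
divisibility. -/
theorem addOrderOf_eq {p : ℕ} {A W : Type*} [AddCommGroup A] [AddCommGroup W]
    {c : A →+ A →+ W} (h : IsCaminaPairing p c) {a : A} (ha : ∀ b, a ≠ p • b) :
    addOrderOf a = AddMonoid.exponent W := by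
  refine Nat.dvd_antisymm (addOrderOf_dvd_of_nsmul_eq_zero (h.exponent_nsmul_eq_zero a)) ?_
  refine AddMonoid.exponent_dvd_of_forall_nsmul_eq_zero fun w => ?_
  obtain ⟨b, rfl⟩ := h.surjective a ha w
  rw [← AddMonoidHom.nsmul_apply, ← map_nsmul, addOrderOf_nsmul_eq_zero]
  simp

theorem exists_addEquiv [Finite A] (hA : ∀ a : A, ∃ k : ℕ, p ^ k • a = 0)
    (h : IsCaminaPairing p c) :
    ∃ r : ℕ, Nonempty (A ≃+ (Fin r → ZMod (AddMonoid.exponent W))) := by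
  classical
  obtain ⟨ι, _, q, hq, ⟨e⟩⟩ := exists_addEquiv_pi_zmod A hA
  have hqn : ∀ i, q i = AddMonoid.exponent W := fun i => by
    have hne : ∀ b, e.symm (Pi.single i 1) ≠ p • b := by
      intro b hb
      have h1 := congrArg (fun a => e a i) hb
      simp only [AddEquiv.apply_symm_apply, Pi.single_eq_same, map_nsmul, Pi.smul_apply] at h1
      have h2 := ZMod.castHom_nsmul_eq_zero (hq i).2 (e b i)
      rw [← h1, map_one] at h2
      exact one_ne_zero h2
    rw [← h.addOrderOf_eq hne, AddEquiv.addOrderOf_eq]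
    have := addOrderOf_injective (AddMonoidHom.single (fun i => ZMod (q i)) i)
      (fun x y hxy => Pi.single_injective i hxy) 1
    rw [AddMonoidHom.single_apply, ZMod.addOrderOf_one] at this
    exact this.symm
  obtain rfl : q = fun _ => AddMonoid.exponent W := funext hqn
  let f : Fin (Fintype.card ι) ≃ ι := (Fintype.equivFin ι).symm
  exact ⟨_, ⟨e.trans (LinearEquiv.funCongrLeft ℤ (ZMod (AddMonoid.exponent W)) f).toAddEquiv⟩⟩

theorem exists_exponent_eq [Finite W] [Nontrivial W] (hW : ∀ w : W, ∃ k : ℕ, p ^ k • w = 0) :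
    ∃ k : ℕ, k ≠ 0 ∧ AddMonoid.exponent W = p ^ k := by
  obtain ⟨w, hw⟩ := AddMonoid.exists_addOrderOf_eq_exponent (G := W)
    (AddMonoid.ExponentExists.of_finite)
  obtain ⟨k, hk⟩ := hW w
  obtain ⟨j, -, hj⟩ := (Nat.dvd_prime_pow hp.out).1 (addOrderOf_dvd_of_nsmul_eq_zero hk)
  refine ⟨j, fun h0 => ?_, hw.symm.trans hj⟩
  have h1 : AddMonoid.exponent W = 1 := by rw [← hw, hj, h0, pow_zero]
  exact not_subsingleton W (AddMonoid.exp_eq_one_iff.1 h1)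

/-- Every homomorphism `f : A →+ W` satisfies `f a ∈ c a (A)` pointwise. -/
theorem mem_range_of_addMonoidHom {p : ℕ} {A W : Type*} [AddCommGroup A] [AddCommGroup W]
    {c : A →+ A →+ W} [Finite A] (hA : ∀ a : A, ∃ k : ℕ, p ^ k • a = 0)
    (h : IsCaminaPairing p c) (f : A →+ W) (a : A) : ∃ b, c a b = f a := by
  -- A uniform exponent, so that an element divisible by every power of `p` is zero.
  obtain ⟨N, hN⟩ : ∃ N : ℕ, ∀ a : A, p ^ N • a = 0 := by
    choose k hk using hA
    have := Fintype.ofFinite A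
    refine ⟨∑ a, k a, fun a => ?_⟩
    obtain ⟨j, hj⟩ := Nat.exists_eq_add_of_le
      (Finset.single_le_sum (fun _ _ => Nat.zero_le _) (Finset.mem_univ a) : k a ≤ ∑ a, k a)
    rw [hj, pow_add, mul_comm, mul_smul, hk, smul_zero]
  by_cases hroot : ∃ k y, p ^ k • y = a ∧ ∀ b, y ≠ p • b
  · obtain ⟨k, y, rfl, hy⟩ := hroot
    obtain ⟨b, hb⟩ := h.surjective y hy (f y)
    exact ⟨b, by rw [map_nsmul, map_nsmul, AddMonoidHom.nsmul_apply, hb]⟩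
  · push Not at hroot
    have : ∀ k, ∃ y, p ^ k • y = a := by
      intro k
      induction k with
      | zero => exact ⟨a, by simp⟩
      | succ k ih =>
        obtain ⟨y, hy⟩ := ih
        obtain ⟨b, rfl⟩ := hroot k y hy
        exact ⟨b, by rw [pow_succ, mul_smul, hy]⟩
    obtain ⟨y, rfl⟩ := this N
    exact ⟨0, by rw [hN]; simp⟩

-- The determinant of the generic combination of the coordinate forms of `c` mod `p` is a square
-- with no nontrivial zero over `𝔽_p`; Chevalley–Warning, applied to its square root, then bounds
-- the number of variables.
open MvPolynomial in
theorem even_and_two_mul_card_le [Nontrivial A] {r n : ℕ} [NeZero n] (hpn : p ∣ n)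
    (h : IsCaminaPairing p c) (e : A ≃+ (Fin r → ZMod n)) {ι : Type*} [Fintype ι] [Nonempty ι] {q : ι → ℕ}
    (hpq : ∀ i, p ∣ q i) (eW : W ≃+ (∀ i, ZMod (q i))) :
    Even r ∧ 2 * Fintype.card ι ≤ r := by
  classical
  let π : ι → (W →+ ZMod p) := fun i => (ZMod.castHom (hpq i) (ZMod p)).toAddMonoidHom.comp
    ((Pi.evalAddMonoidHom _ i).comp eW.toAddMonoidHom)
  have hπ : ∀ v : ι → ZMod p, ∃ w, ∀ i, π i w = v i := by
    intro v
    choose x hx using fun i => ZMod.castHom_surjective (hpq i) (v i)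
    exact ⟨eW.symm x, fun i => by simpa [π] using hx i⟩
  let ψ : A → (Fin r → ZMod p) := fun a j => ZMod.castHom hpn (ZMod p) (e a j)
  have hψ : Function.Surjective ψ := by
    intro v
    choose x hx using fun i => ZMod.castHom_surjective hpn (v i)
    exact ⟨e.symm x, by ext j; simpa [ψ] using hx j⟩
  have hψval : ∀ a j, (((e a j).val : ℕ) : ZMod p) = ψ a j := fun a j => by
    conv_rhs => simp only [ψ]; rw [← ZMod.natCast_zmod_val (e a j), map_natCast]
  have hψp : ∀ a, ψ a ≠ 0 → ∀ b, a ≠ p • b := by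
    rintro _ ha b rfl
    refine ha (funext fun j => ?_)
    have := ZMod.castHom_nsmul_eq_zero hpn (e b j)
    simp only [ψ, map_nsmul e]
    exact this
  let x := stdGen e
  have hform : ∀ i a b, π i (c a b) = ∑ j, ∑ k, ψ a j * ψ b k * π i (c (x j) (x k)) := by
    intro i a b
    conv_lhs => rw [sum_val_nsmul_stdGen e a, sum_val_nsmul_stdGen e b]
    simp only [map_sum, AddMonoidHom.finsetSum_apply, map_nsmul, AddMonoidHom.nsmul_apply,
      nsmul_eq_mul, hψval, x, Finset.mul_sum]
    rw [Finset.sum_comm]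
    refine Finset.sum_congr rfl fun j _ => Finset.sum_congr rfl fun k _ => ?_
    ring
  let M : Matrix (Fin r) (Fin r) (MvPolynomial ι (ZMod p)) :=
    Matrix.of fun j k => ∑ i, C (π i (c (x j) (x k))) * X i
  have hMdiag : ∀ j, M j j = 0 := fun j => by simp [M, h.self_eq_zero]
  have hMskew : ∀ j k, M j k = -M k j := fun j k => by
    simp only [M, Matrix.of_apply, ← Finset.sum_neg_distrib]
    refine Finset.sum_congr rfl fun i _ => ?_
    rw [h.skew (x j) (x k)]
    simp
  have heval : ∀ t, eval t M.det =
      (Matrix.of fun j k => ∑ i, π i (c (x j) (x k)) * t i).det := by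
    intro t
    rw [RingHom.map_det]
    congr 1
    ext j k
    simp [M]
  have hne : ∀ t : ι → ZMod p, t ≠ 0 → eval t M.det ≠ 0 := by
    intro t ht h0
    rw [heval, ← Matrix.exists_vecMul_eq_zero_iff] at h0
    obtain ⟨v, hv0, hv⟩ := h0
    obtain ⟨a, rfl⟩ := hψ v
    have hzero : ∀ b, ∑ i, π i (c a b) * t i = 0 := by
      intro b
      have := congrArg (fun u => u ⬝ᵥ ψ b) hv
      simp only [zero_dotProduct] at this
      rw [← this, Finset.sum_congr rfl fun i _ => by rw [hform i a b]]
      simp only [dotProduct, Matrix.vecMul, Matrix.of_apply, Finset.sum_mul, Finset.mul_sum]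
      rw [Finset.sum_comm]
      conv_rhs => rw [Finset.sum_comm]
      refine Finset.sum_congr rfl fun j _ => ?_
      rw [Finset.sum_comm]
      refine Finset.sum_congr rfl fun k _ => Finset.sum_congr rfl fun i _ => ?_
      ring
    -- Surjectivity of `c a` provides `b` for which the combined form takes the value `t i ≠ 0`, so
    -- `a` cannot be in its radical.
    obtain ⟨i, hi⟩ := Function.ne_iff.1 ht
    obtain ⟨w, hw⟩ := hπ (Pi.single i 1)
    obtain ⟨b, rfl⟩ := h.surjective a (hψp a hv0) w
    have := hzero b
    simp only [hw] at this
    simp [Pi.single_apply] at this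
    exact hi this
  have hdet : M.det ≠ 0 := by
    intro h0
    refine hne 1 one_ne_zero ?_
    rw [h0, map_zero]
  obtain ⟨hr, Q, hQ⟩ := Matrix.exists_det_eq_mul_self_of_alternating M hMdiag hMskew hdet
  refine ⟨hr, ?_⟩
  have hdeg : M.det.totalDegree ≤ r := by
    have hhom : M.det.IsHomogeneous r := by
      rw [Matrix.det_apply]
      refine IsHomogeneous.sum _ _ _ fun σ _ => ?_
      have h1 : (∏ i, M (σ i) i).IsHomogeneous r := by
        have := IsHomogeneous.prod Finset.univ (fun i => M (σ i) i) (fun _ => 1) fun i _ => by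
          refine IsHomogeneous.sum _ _ _ fun k _ => ?_
          simpa using (isHomogeneous_C ι _).mul (isHomogeneous_X (ZMod p) k)
        simpa using this
      rcases Int.units_eq_one_or (Equiv.Perm.sign σ) with hs | hs
      · simpa [hs] using h1
      · simpa [hs] using h1.neg
    exact (hhom.totalDegree hdet).le
  have hQ0 : Q ≠ 0 := by
    rintro rfl
    exact hdet (by simpa using hQ)
  rw [hQ, totalDegree_mul_of_isDomain hQ0 hQ0] at hdeg
  by_contra hlt
  -- Needed for the origin to be a zero: the empty determinant is 1.
  have hr0 : r ≠ 0 := by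
    rintro rfl
    exact not_subsingleton A e.toEquiv.subsingleton
  have hcw := char_dvd_card_solutions p (f := Q) (by omega)
  have hiff : ∀ t, eval t Q = 0 ↔ t = 0 := by
    intro t
    constructor
    · intro ht
      by_contra ht0
      exact hne t ht0 (by rw [hQ, map_mul, ht, mul_zero])
    · rintro rfl
      have h0 : eval (0 : ι → ZMod p) M.det = 0 := by
        rw [heval]
        have : Nonempty (Fin r) := ⟨⟨0, Nat.pos_of_ne_zero hr0⟩⟩
        have : (Matrix.of fun j k => ∑ i, π i (c (x j) (x k)) * (0 : ι → ZMod p) i) = 0 := by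
          ext j k
          simp
        rw [this, Matrix.det_zero]
      rw [hQ, map_mul] at h0
      exact mul_self_eq_zero.1 h0
  have hcard : Fintype.card {t : ι → ZMod p // eval t Q = 0} = 1 := by
    rw [Fintype.card_eq_one_iff]
    exact ⟨⟨0, (hiff 0).2 rfl⟩, fun t => Subtype.ext ((hiff _).1 t.2)⟩
  rw [hcard] at hcw
  exact hp.out.one_lt.ne' (Nat.dvd_one.1 hcw)

/-- Through `θ` the pairing becomes a form over the local ring `ZMod n`, and `p • A ⊆ 𝔪 • A`, so
surjectivity outside `p • A` is enough for a symplectic basis. -/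
theorem exists_symplectic_linearEquiv [Finite A] {n k : ℕ} (hk : k ≠ 0) (hnk : n = p ^ k)
    (h : IsCaminaPairing p c) [Module (ZMod n) A] (θ : W ≃+ ZMod n) :
    ∃ (m : ℕ) (E : ((Fin m → ZMod n) × (Fin m → ZMod n)) ≃ₗ[ZMod n] A), ∀ u v,
      θ (c (E u) (E v)) = ∑ i, (u.1 i * v.2 i - u.2 i * v.1 i) := by
  have : IsLocalRing (ZMod n) := hnk ▸ ZMod.isLocalRing_prime_pow hk
  let B : A →ₗ[ZMod n] A →ₗ[ZMod n] ZMod n :=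
    LinearMap.mk₂ (ZMod n) (fun a b => θ (c a b)) (by simp)
      (fun t a b => ZMod.map_smul (θ.toAddMonoidHom.comp (c.flip b)) t a) (by simp)
      (fun t a b => ZMod.map_smul (θ.toAddMonoidHom.comp (c a)) t b)
  have hBapp : ∀ a b, B a b = θ (c a b) := fun a b => rfl
  have hB : B.IsAlt := fun a => by rw [hBapp, h.self_eq_zero, map_zero]
  obtain ⟨m, b, hb⟩ := exists_symplectic_basis hB (by
    intro a ha
    obtain ⟨b, hb⟩ := h.surjective a (by
      rintro b rfl
      refine ha ?_
      have : p • b = (p : ZMod n) • b := (Nat.cast_smul_eq_nsmul _ p b).symm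
      rw [this]
      refine Submodule.smul_mem_smul ?_ Submodule.mem_top
      rw [IsLocalRing.mem_maximalIdeal, mem_nonunits_iff, ZMod.isUnit_iff_coprime, hnk]
      intro hco
      have := (Nat.coprime_pow_right_iff (Nat.pos_of_ne_zero hk) _ _).1 hco
      rw [Nat.coprime_self] at this
      exact hp.out.one_lt.ne' this) (θ.symm 1)
    exact ⟨b, by rw [hBapp, hb, AddEquiv.apply_symm_apply]⟩)
  let E : ((Fin m → ZMod n) × (Fin m → ZMod n)) ≃ₗ[ZMod n] A :=
    (LinearEquiv.sumArrowLequivProdArrow _ _ _ _).symm.trans b.equivFun.symm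
  have hE : ∀ u, E u = ∑ i, u.1 i • b (Sum.inl i) + ∑ i, u.2 i • b (Sum.inr i) := by
    intro u
    simp only [E, LinearEquiv.trans_apply, Module.Basis.equivFun_symm_apply,
      Fintype.sum_sum_type]
    rfl
  refine ⟨m, E, fun u v => ?_⟩
  change B (E u) (E v) = _
  simp only [hE, map_add, map_sum, LinearMap.add_apply, LinearMap.sum_apply, map_smul,
    LinearMap.smul_apply, hb.left_left, hb.left_right, hb.right_left, hb.right_right]
  simp [sub_eq_add_neg, Finset.sum_add_distrib, mul_comm, add_comm]

theorem exists_symplectic_addEquiv [Finite A] {n k : ℕ} (hk : k ≠ 0) (hnk : n = p ^ k)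
    (h : IsCaminaPairing p c) (hn : ∀ a : A, n • a = 0) (θ : W ≃+ ZMod n) :
    ∃ (m : ℕ) (E : ((Fin m → ZMod n) × (Fin m → ZMod n)) ≃+ A), ∀ u v,
      θ (c (E u) (E v)) = ∑ i, (u.1 i * v.2 i - u.2 i * v.1 i) := by
  let _ : Module (ZMod n) A := AddCommGroup.zmodModule hn
  obtain ⟨m, E, hE⟩ := h.exists_symplectic_linearEquiv hk hnk θ
  exact ⟨m, E.toAddEquiv, hE⟩

end IsCaminaPairing

/-! ### Commutator calculus in class two. -/

section Rcomm

variable {G : Type*} [Group G]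

theorem rcomm_eq_one_iff {x y : G} : rcomm x y = 1 ↔ x * y = y * x := by
  rw [rcomm, show x⁻¹ * y⁻¹ * x * y = (y * x)⁻¹ * (x * y) by group, inv_mul_eq_one, eq_comm]

theorem rcomm_self (x : G) : rcomm x x = 1 := rcomm_eq_one_iff.2 rfl

theorem mul_rcomm (x y : G) : x * rcomm x y = y⁻¹ * x * y := by
  simp only [rcomm]
  group

theorem rcomm_mul_left (h : commutator G ≤ Subgroup.center G) (x x' y : G) :
    rcomm (x * x') y = rcomm x y * rcomm x' y := by
  have h1 := Subgroup.mem_center_iff.1 (h (rcomm_mem_commutator x y)) x'⁻¹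
  have h2 : rcomm (x * x') y = x'⁻¹ * rcomm x y * x' * rcomm x' y := by
    simp only [rcomm]
    group
  rw [h2, h1]
  group

theorem rcomm_mul_right (h : commutator G ≤ Subgroup.center G) (x y y' : G) :
    rcomm x (y * y') = rcomm x y * rcomm x y' := by
  have h1 := Subgroup.mem_center_iff.1 (h (rcomm_mem_commutator x y)) y'
  have h2 : rcomm x (y * y') = rcomm x y' * (y'⁻¹ * rcomm x y * y') := by
    simp only [rcomm]
    group
  have h3 := Subgroup.mem_center_iff.1 (h (rcomm_mem_commutator x y)) (rcomm x y')
  rw [h2, mul_assoc, ← h1, inv_mul_cancel_left, h3]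

theorem rcomm_eq_one_of_mem_center_left {x : G} (hx : x ∈ Subgroup.center G) (y : G) :
    rcomm x y = 1 := rcomm_eq_one_iff.2 (Subgroup.mem_center_iff.1 hx y).symm

theorem rcomm_eq_one_of_mem_center_right {y : G} (hy : y ∈ Subgroup.center G) (x : G) :
    rcomm x y = 1 := rcomm_eq_one_iff.2 (Subgroup.mem_center_iff.1 hy x)

theorem isMulCommutative_commutator_of_le_center (h : commutator G ≤ Subgroup.center G) :
    IsMulCommutative (commutator G) :=
  ⟨⟨fun a b => Subtype.ext (Subgroup.mem_center_iff.1 (h b.2) a)⟩⟩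

theorem isMulCommutative_quotient_center_of_commutator_le (h : commutator G ≤ Subgroup.center G) :
    IsMulCommutative (G ⧸ Subgroup.center G) := by
  refine ⟨⟨fun a b => ?_⟩⟩
  obtain ⟨x, rfl⟩ := QuotientGroup.mk_surjective a
  obtain ⟨y, rfl⟩ := QuotientGroup.mk_surjective b
  rw [← QuotientGroup.mk_mul, ← QuotientGroup.mk_mul, eq_comm, QuotientGroup.eq]
  have : (y * x)⁻¹ * (x * y) = rcomm x y := by
    simp only [rcomm]
    group
  rw [this]
  exact h (rcomm_mem_commutator x y)

end Rcomm

/-! ### From Camina-type groups to Camina pairings. -/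

section CommPairing

open scoped IsMulCommutative

theorem IsPGroup.exists_nsmul_eq_zero {p : ℕ} {M : Type*} [Group M] [IsMulCommutative M]
    (hM : IsPGroup p M) (a : Additive M) : ∃ k : ℕ, p ^ k • a = 0 := by
  obtain ⟨k, hk⟩ := hM a.toMul
  exact ⟨k, hk⟩

theorem frattini_eq_bot_of_card_prime {p : ℕ} [hp : Fact p.Prime] {M : Type*} [Group M]
    [IsMulCommutative M] (hM : Nat.card M = p) : frattini M = ⊥ := by
  have : IsSimpleGroup M := isSimpleGroup_of_prime_card hM
  exact le_bot_iff.1 (frattini_le_coatom isCoatom_bot)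

/-- A homomorphism to `ZMod p` not killing `x` is onto, and so carries `Φ(G)` into `Φ(ZMod p) = 1`.
-/
theorem notMem_frattini_of_forall_ne_nsmul {p : ℕ} [hp : Fact p.Prime] {G : Type*} [Group G]
    [IsMulCommutative (G ⧸ Subgroup.center G)] [Finite G] (hG : IsPGroup p G) {x : G}
    (hx : ∀ b, Additive.ofMul (x : G ⧸ Subgroup.center G) ≠ p • b) : x ∉ frattini G := by
  obtain ⟨f, hf⟩ := exists_addMonoidHom_zmod_ne_zero
    (hG.to_quotient (Subgroup.center G)).exists_nsmul_eq_zero hx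
  let φ : G →* Multiplicative (ZMod p) :=
    (AddMonoidHom.toMultiplicativeRight f).comp (QuotientGroup.mk' _)
  have hφx : φ x ≠ 1 := hf
  have hcard : Nat.card (Multiplicative (ZMod p)) = p := by simp
  have : IsSimpleGroup (Multiplicative (ZMod p)) := isSimpleGroup_of_prime_card hcard
  have hsurj : Function.Surjective φ := by
    rw [← MonoidHom.range_eq_top]
    refine (eq_bot_or_eq_top φ.range).resolve_left fun hbot => hφx ?_
    have : φ x ∈ φ.range := ⟨x, rfl⟩
    rwa [hbot, Subgroup.mem_bot] at this
  intro hmem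
  have := frattini_le_comap_frattini_of_surjective hsurj hmem
  rw [frattini_eq_bot_of_card_prime hcard, Subgroup.mem_comap, Subgroup.mem_bot] at this
  exact hφx this

/-- A central `x` outside `Φ(G)` would give `γ₂(G) = [x, G] = 1`. -/
theorem IsCaminaType.center_le_frattini {G : Type*} [Group G] (hG : IsCaminaType G) :
    Subgroup.center G ≤ frattini G := by
  intro x hx
  by_contra hxf
  obtain ⟨y, z, hyz⟩ := hG.nonabelian
  have hmem : rcomm y z ∈ commSet x := by
    rw [hG.commSet_eq x hxf]
    exact rcomm_mem_commutator y z
  obtain ⟨g, hg⟩ := hmem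
  refine hyz (rcomm_eq_one_iff.1 ?_)
  rw [← hg]
  exact rcomm_eq_one_of_mem_center_left hx g

variable {G : Type*} [Group G] [IsMulCommutative (commutator G)]

/-- The commutator map of a group of class at most two, as a bimultiplicative map on `G`. -/
def rcommHom (h : commutator G ≤ Subgroup.center G) : G →* G →* commutator G :=
  MonoidHom.mk' (fun x => MonoidHom.mk' (fun y => ⟨rcomm x y, rcomm_mem_commutator x y⟩)
    fun y y' => Subtype.ext (rcomm_mul_right h x y y'))
    fun x x' => MonoidHom.ext fun y => Subtype.ext (rcomm_mul_left h x x' y)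

/-- The commutator map of a group of class at most two, as a bimultiplicative map on
`G ⧸ Z(G)`. -/
def rcommQuotientHom (h : commutator G ≤ Subgroup.center G) :
    G ⧸ Subgroup.center G →* G ⧸ Subgroup.center G →* commutator G :=
  QuotientGroup.lift (Subgroup.center G)
    (MonoidHom.mk' (fun x => QuotientGroup.lift (Subgroup.center G) (rcommHom h x)
      fun y hy => Subtype.ext (rcomm_eq_one_of_mem_center_right hy x))
      fun x x' => MonoidHom.ext fun y => by
        obtain ⟨y, rfl⟩ := QuotientGroup.mk_surjective y
        exact Subtype.ext (rcomm_mul_left h x x' y))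
    fun x hx => MonoidHom.ext fun y => by
      obtain ⟨y, rfl⟩ := QuotientGroup.mk_surjective y
      exact Subtype.ext (rcomm_eq_one_of_mem_center_left hx y)

/-- The commutator map of a group of class at most two, written additively. -/
def commPairing (h : commutator G ≤ Subgroup.center G) :
    Additive (G ⧸ Subgroup.center G) →+ Additive (G ⧸ Subgroup.center G) →+
      Additive (commutator G) :=
  AddMonoidHom.mk' (fun a => (rcommQuotientHom h a.toMul).toAdditive) fun a a' => by
    rw [toMul_add, map_mul]
    rfl

theorem commPairing_mk (h : commutator G ≤ Subgroup.center G) (x y : G) :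
    commPairing h (Additive.ofMul (x : G ⧸ Subgroup.center G))
      (Additive.ofMul (y : G ⧸ Subgroup.center G)) =
      Additive.ofMul ⟨rcomm x y, rcomm_mem_commutator x y⟩ := rfl

theorem IsCaminaType.isCaminaPairing [IsMulCommutative (G ⧸ Subgroup.center G)]
    {p : ℕ} [hp : Fact p.Prime] [Finite G]
    (hpG : IsPGroup p G) (hG : IsCaminaType G) (h : commutator G ≤ Subgroup.center G) :
    IsCaminaPairing p (commPairing h) where
  self_eq_zero a := by
    obtain ⟨x, rfl⟩ := QuotientGroup.mk_surjective a
    exact Subtype.ext (rcomm_self x)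
  eq_zero a ha := by
    obtain ⟨x, rfl⟩ := QuotientGroup.mk_surjective a
    refine (QuotientGroup.eq_one_iff x).2 (Subgroup.mem_center_iff.2 fun y => ?_)
    exact (rcomm_eq_one_iff.1 (congrArg Subtype.val (ha (QuotientGroup.mk y)))).symm
  surjective a ha w := by
    obtain ⟨x, rfl⟩ := QuotientGroup.mk_surjective a
    have hw : (w.toMul : G) ∈ commSet x := by
      rw [hG.commSet_eq x (notMem_frattini_of_forall_ne_nsmul hpG ha)]
      exact w.toMul.2
    obtain ⟨y, hy⟩ := hw
    exact ⟨Additive.ofMul (QuotientGroup.mk y), Subtype.ext hy⟩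

end CommPairing

/-! ### Ranks of `G` and of abelian groups. -/

section Rank

open scoped IsMulCommutative

theorem Group.rank_le_card_of_additive_equiv {M ι : Type*} [Group M] [IsMulCommutative M]
    [Group.FG M] [Fintype ι] {q : ι → ℕ} [∀ i, NeZero (q i)]
    (e : Additive M ≃+ (∀ i, ZMod (q i))) : Group.rank M ≤ Fintype.card ι := by
  classical
  let S : Finset M := Finset.univ.image fun i => (stdGen e i).toMul
  refine (Group.rank_le (S := S) ?_).trans Finset.card_image_le
  rw [eq_top_iff]
  intro x _
  have hx : Additive.ofMul x ∈ AddSubgroup.closure (Set.range (stdGen e)) := by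
    rw [closure_range_stdGen]
    exact AddSubgroup.mem_top _
  refine AddSubgroup.closure_induction
    (p := fun a _ => a.toMul ∈ Subgroup.closure (S : Set M)) ?_ ?_ ?_ ?_ hx
  · rintro _ ⟨i, rfl⟩
    exact Subgroup.subset_closure (by simp [S])
  · exact one_mem _
  · intro a b _ _ ha hb
    exact mul_mem ha hb
  · intro a _ ha
    exact inv_mem ha

theorem le_rank_multiplicative_pi_zmod (p r : ℕ) [hp : Fact p.Prime] :
    r ≤ Group.rank (Multiplicative (Fin r → ZMod p)) := by
  classical
  obtain ⟨S, hcard, hS⟩ := Group.rank_spec (Multiplicative (Fin r → ZMod p))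
  rw [← hcard]
  let T : Finset (Fin r → ZMod p) := S.map Multiplicative.toAdd.toEmbedding
  have hT : Submodule.span (ZMod p) (T : Set (Fin r → ZMod p)) = ⊤ := by
    rw [eq_top_iff]
    intro v _
    have hv : Multiplicative.ofAdd v ∈ Subgroup.closure (S : Set (Multiplicative _)) := by
      rw [hS]
      exact Subgroup.mem_top _
    refine Subgroup.closure_induction
      (p := fun w _ => w.toAdd ∈ Submodule.span (ZMod p) (T : Set (Fin r → ZMod p)))
      ?_ ?_ ?_ ?_ hv
    · intro x hx
      exact Submodule.subset_span (by simpa [T] using hx)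
    · exact zero_mem _
    · intro x y _ _ hx hy
      exact add_mem hx hy
    · intro x _ hx
      exact neg_mem hx
  have := finrank_span_finset_le_card (R := ZMod p) T
  rw [Set.finrank, hT, finrank_top, Module.finrank_fin_fun] at this
  simpa [T] using this

/-- Lifts of generators of `G/Z(G)` generate `G`, because `Z(G)` consists of nongenerators;
conversely `G` maps onto `𝔽_p ^ r`. -/
theorem Group.rank_eq_of_quotient_center {G : Type*} [Group G] [Finite G]
    [IsMulCommutative (G ⧸ Subgroup.center G)] (hZ : Subgroup.center G ≤ frattini G)
    {p r n : ℕ} [hp : Fact p.Prime] [NeZero n] (hpn : p ∣ n)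
    (e : Additive (G ⧸ Subgroup.center G) ≃+ (Fin r → ZMod n)) : Group.rank G = r := by
  classical
  apply le_antisymm
  · have hle := Group.rank_le_card_of_additive_equiv e
    rw [Fintype.card_fin] at hle
    refine le_trans ?_ hle
    obtain ⟨S, hcard, hS⟩ := Group.rank_spec (G ⧸ Subgroup.center G)
    rw [← hcard]
    let T : Finset G := S.image Quotient.out
    refine (Group.rank_le (S := T) ?_).trans Finset.card_image_le
    refine frattini_nongenerating (top_le_iff.1 ?_)
    refine le_trans ?_ (sup_le_sup_left hZ _)
    have hmap : (Subgroup.closure (T : Set G)).map (QuotientGroup.mk' (Subgroup.center G)) = ⊤ := by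
      rw [MonoidHom.map_closure, ← hS]
      congr 1
      ext a
      simp [T]
    have := Subgroup.comap_map_eq (QuotientGroup.mk' (Subgroup.center G))
      (Subgroup.closure (T : Set G))
    rw [hmap, Subgroup.comap_top, QuotientGroup.ker_mk'] at this
    exact this.le
  · refine (le_rank_multiplicative_pi_zmod p r).trans ?_
    let f : Additive (G ⧸ Subgroup.center G) →+ (Fin r → ZMod p) :=
      ((ZMod.castHom hpn (ZMod p)).toAddMonoidHom.compLeft (Fin r)).comp e.toAddMonoidHom
    have hf : Function.Surjective f := by
      intro v
      choose x hx using fun i => ZMod.castHom_surjective hpn (v i)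
      exact ⟨e.symm x, by ext j; simpa [f] using hx j⟩
    refine Group.rank_le_of_surjective
      ((AddMonoidHom.toMultiplicativeRight f).comp (QuotientGroup.mk' _)) ?_
    exact (show Function.Surjective (AddMonoidHom.toMultiplicativeRight f) from hf).comp
      (QuotientGroup.mk'_surjective _)

end Rank

/-! ### Class-preserving automorphisms as homomorphisms. -/

section AutC

open scoped IsMulCommutative

variable {G : Type*} [Group G] [IsMulCommutative (commutator G)]
  [IsMulCommutative (G ⧸ Subgroup.center G)]

/-- The automorphism `x ↦ x * f x` attached to a homomorphism `f : G ⧸ Z(G) → γ₂(G)`. -/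
def centralAut (h : commutator G ≤ Subgroup.center G)
    (f : Additive (G ⧸ Subgroup.center G) →+ Additive (commutator G)) : MulAut G :=
  let φ : G →* commutator G := (AddMonoidHom.toMultiplicative f).comp (QuotientGroup.mk' _)
  -- As `γ₂(G) ≤ Z(G)`, `φ` kills its own values, which makes `x ↦ x * (φ x)⁻¹` the inverse.
  have hφφ : ∀ w : commutator G, φ w = 1 := fun w => by
    have : QuotientGroup.mk' (Subgroup.center G) (w : G) = 1 :=
      (QuotientGroup.eq_one_iff _).2 (h w.2)
    change AddMonoidHom.toMultiplicative f (QuotientGroup.mk' _ (w : G)) = 1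
    rw [this]
    exact map_zero f
  MulEquiv.mk'
    { toFun := fun x => x * φ x
      invFun := fun x => x * (φ x)⁻¹
      left_inv := fun x => by simp [map_mul, hφφ]
      right_inv := fun x => by
        have := hφφ (φ x)⁻¹
        rw [Subgroup.coe_inv] at this
        simp [map_mul, hφφ] }
    fun x y => by
      have := Subgroup.mem_center_iff.1 (h (φ x).2) y
      simp only [Equiv.coe_fn_mk, map_mul, Subgroup.coe_mul]
      rw [mul_assoc x y, ← mul_assoc y, this]
      simp only [mul_assoc]

theorem centralAut_apply (h : commutator G ≤ Subgroup.center G)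
    (f : Additive (G ⧸ Subgroup.center G) →+ Additive (commutator G)) (x : G) :
    centralAut h f x =
      x * ((f (Additive.ofMul (x : G ⧸ Subgroup.center G))).toMul : commutator G) := rfl

/-- If every homomorphism `G ⧸ Z(G) → γ₂(G)` takes values in the commutator sets pointwise, then
the class-preserving automorphisms correspond to these homomorphisms. -/
theorem natCard_autC (h : commutator G ≤ Subgroup.center G)
    (hf : ∀ (f : Additive (G ⧸ Subgroup.center G) →+ Additive (commutator G)) a,
      ∃ b, commPairing h a b = f a) :
    Nat.card (autC G) =
      Nat.card (Additive (G ⧸ Subgroup.center G) →+ Additive (commutator G)) := by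
  have hmem : ∀ f, centralAut h f ∈ autC G := by
    intro f x
    obtain ⟨b, hb⟩ := hf f (Additive.ofMul (x : G ⧸ Subgroup.center G))
    obtain ⟨y, rfl⟩ := QuotientGroup.mk_surjective b
    rw [centralAut_apply, ← hb, isConj_iff]
    exact ⟨y⁻¹, by rw [inv_inv]; exact (mul_rcomm x y).symm⟩
  symm
  refine Nat.card_eq_of_bijective (fun f => (⟨centralAut h f, hmem f⟩ : autC G)) ⟨?_, ?_⟩
  · intro f g hfg
    refine AddMonoidHom.ext fun a => ?_
    obtain ⟨x, rfl⟩ := QuotientGroup.mk_surjective a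
    have := DFunLike.congr_fun (congrArg Subtype.val hfg) x
    exact Subtype.ext (mul_left_cancel this)
  · rintro ⟨α, hα⟩
    have hαmem : ∀ x, x⁻¹ * α x ∈ commutator G := by
      intro x
      obtain ⟨g, hg⟩ := isConj_iff.1 (hα x)
      rw [← hg]
      convert rcomm_mem_commutator x g⁻¹ using 1
      simp only [rcomm]
      group
    let φ : G →* commutator G := MonoidHom.mk' (fun x => ⟨x⁻¹ * α x, hαmem x⟩) fun x y => by
      apply Subtype.ext
      have := Subgroup.mem_center_iff.1 (h (hαmem x)) y⁻¹
      simp only [map_mul, Subgroup.coe_mul]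
      rw [← mul_assoc _ y⁻¹, ← this]
      group
    have hφ : ∀ x ∈ Subgroup.center G, φ x = 1 := by
      intro x hx
      obtain ⟨g, hg⟩ := isConj_iff.1 (hα x)
      refine Subtype.ext ?_
      change x⁻¹ * α x = 1
      rw [← hg, Subgroup.mem_center_iff.1 hx g]
      group
    refine ⟨MonoidHom.toAdditive (QuotientGroup.lift _ φ hφ),
      Subtype.ext (MulEquiv.ext fun x => ?_)⟩
    exact mul_inv_cancel_left x (α x)

end AutC

/-! ### Nilpotency class two and noncommutativity. -/

section Class

theorem nilpotencyClass_eq_two {G : Type*} [Group G] (h : commutator G ≤ Subgroup.center G)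
    (hne : ∃ x y : G, x * y ≠ y * x) : Group.nilpotencyClass G = 2 := by
  have h2 : Subgroup.lowerCentralSeries (⊤ : Subgroup G) 2 = ⊥ := by
    rw [Subgroup.lowerCentralSeries_succ, Subgroup.top_lowerCentralSeries_one]
    exact Subgroup.commutator_top_right_eq_bot_iff_le_center.2 h
  have hnil : Group.IsNilpotent G := Subgroup.nilpotent_iff_lowerCentralSeries.2 ⟨2, h2⟩
  refine le_antisymm (Subgroup.lowerCentralSeries_eq_bot_iff_nilpotencyClass_le.1 h2) ?_
  by_contra hlt
  have h1 : Subgroup.lowerCentralSeries (⊤ : Subgroup G) 1 = ⊥ :=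
    Subgroup.lowerCentralSeries_eq_bot_iff_nilpotencyClass_le.2 (by omega)
  rw [Subgroup.top_lowerCentralSeries_one] at h1
  obtain ⟨x, y, hxy⟩ := hne
  refine hxy (rcomm_eq_one_iff.1 ?_)
  have := rcomm_mem_commutator x y
  rwa [h1, Subgroup.mem_bot] at this

theorem commutator_le_center_of_nilpotencyClass_le_two {G : Type*} [Group G] [Group.IsNilpotent G]
    (h : Group.nilpotencyClass G ≤ 2) : commutator G ≤ Subgroup.center G := by
  have h2 := Subgroup.lowerCentralSeries_eq_bot_iff_nilpotencyClass_le.2 h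
  rw [Subgroup.lowerCentralSeries_succ, Subgroup.top_lowerCentralSeries_one] at h2
  exact Subgroup.commutator_top_right_eq_bot_iff_le_center.1 h2

theorem two_le_rank_of_nonabelian {G : Type*} [Group G] [Group.FG G]
    (hne : ∃ x y : G, x * y ≠ y * x) : 2 ≤ Group.rank G := by
  obtain ⟨S, hcard, hS⟩ := Group.rank_spec G
  by_contra hlt
  obtain ⟨x, y, hxy⟩ := hne
  have hS1 : ∀ a ∈ (S : Set G), ∀ b ∈ (S : Set G), a * b = b * a := fun a ha b hb => by
    rw [Finset.card_le_one.1 (by omega : S.card ≤ 1) a ha b hb]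
  have hcomm : IsMulCommutative (Subgroup.closure (S : Set G)) :=
    Subgroup.isMulCommutative_closure hS1
  have hx : x ∈ Subgroup.closure (S : Set G) := hS ▸ Subgroup.mem_top x
  have hy : y ∈ Subgroup.closure (S : Set G) := hS ▸ Subgroup.mem_top y
  exact hxy (congrArg Subtype.val (hcomm.is_comm.comm ⟨x, hx⟩ ⟨y, hy⟩))

end Class

/-! ### Heisenberg groups as full central products. -/

/-- The Heisenberg group over `R` of triples `(a, b, c)` with `a b : ι → R` and `c : R`. -/
@[ext]
structure Heisenberg (R ι : Type*) where
  /-- The first coordinate vector. -/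
  a : ι → R
  /-- The second coordinate vector. -/
  b : ι → R
  /-- The central coordinate. -/
  c : R

namespace Heisenberg

variable {R ι : Type*}

/-- The Heisenberg group as a product of sets. -/
def equivProd : Heisenberg R ι ≃ (ι → R) × (ι → R) × R where
  toFun x := (x.a, x.b, x.c)
  invFun x := ⟨x.1, x.2.1, x.2.2⟩
  left_inv _ := rfl
  right_inv _ := rfl

instance [Finite R] [Finite ι] : Finite (Heisenberg R ι) := Finite.of_equiv _ equivProd.symm

variable [CommRing R]

instance : One (Heisenberg R ι) := ⟨⟨0, 0, 0⟩⟩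

@[simp] theorem one_a : (1 : Heisenberg R ι).a = 0 := rfl
@[simp] theorem one_b : (1 : Heisenberg R ι).b = 0 := rfl
@[simp] theorem one_c : (1 : Heisenberg R ι).c = 0 := rfl

variable [Fintype ι]

instance : Mul (Heisenberg R ι) := ⟨fun x y => ⟨x.a + y.a, x.b + y.b, x.c + y.c + x.a ⬝ᵥ y.b⟩⟩
instance : Inv (Heisenberg R ι) := ⟨fun x => ⟨-x.a, -x.b, -x.c + x.a ⬝ᵥ x.b⟩⟩

@[simp] theorem mul_a (x y : Heisenberg R ι) : (x * y).a = x.a + y.a := rfl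
@[simp] theorem mul_b (x y : Heisenberg R ι) : (x * y).b = x.b + y.b := rfl
@[simp] theorem mul_c (x y : Heisenberg R ι) : (x * y).c = x.c + y.c + x.a ⬝ᵥ y.b := rfl
@[simp] theorem inv_a (x : Heisenberg R ι) : (x⁻¹).a = -x.a := rfl
@[simp] theorem inv_b (x : Heisenberg R ι) : (x⁻¹).b = -x.b := rfl
@[simp] theorem inv_c (x : Heisenberg R ι) : (x⁻¹).c = -x.c + x.a ⬝ᵥ x.b := rfl

instance : Group (Heisenberg R ι) :=
  Group.ofLeftAxioms
    (fun x y z => by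
      ext <;> simp [add_assoc]
      ring)
    (fun x => by ext <;> simp)
    (fun x => by ext <;> simp)

theorem mul_comm_iff (x y : Heisenberg R ι) :
    x * y = y * x ↔ x.a ⬝ᵥ y.b = y.a ⬝ᵥ x.b := by
  rw [Heisenberg.ext_iff]
  simp [add_comm]

theorem rcomm_eq (x y : Heisenberg R ι) : rcomm x y = ⟨0, 0, x.a ⬝ᵥ y.b - y.a ⬝ᵥ x.b⟩ := by
  have h : rcomm x y = (y * x)⁻¹ * (x * y) := by
    simp only [rcomm]
    group
  rw [h, inv_mul_eq_iff_eq_mul]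
  ext
  · simp [add_comm]
  · simp [add_comm]
  · simp
    ring

theorem mem_center_of_eq_zero {x : Heisenberg R ι} (ha : x.a = 0) (hb : x.b = 0) :
    x ∈ Subgroup.center (Heisenberg R ι) :=
  Subgroup.mem_center_iff.2 fun y => by
    rw [mul_comm_iff, ha, hb]
    simp

theorem commutator_le_center :
    commutator (Heisenberg R ι) ≤ Subgroup.center (Heisenberg R ι) := by
  rw [commutator_def, Subgroup.commutator_le]
  intro x _ y _
  have : ⁅x, y⁆ = rcomm x⁻¹ y⁻¹ := by simp [rcomm, commutatorElement_def]
  rw [this, rcomm_eq]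
  exact mem_center_of_eq_zero rfl rfl

theorem isPGroup {p k : ℕ} [Finite R] (hR : Nat.card R = p ^ k) : IsPGroup p (Heisenberg R ι) := by
  refine IsPGroup.of_card (n := k * (2 * Fintype.card ι + 1)) ?_
  rw [Nat.card_congr equivProd, Nat.card_prod, Nat.card_prod, Nat.card_fun, hR,
    Nat.card_eq_fintype_card]
  ring

/-- The elements supported on the coordinate `i`. -/
def factor (R : Type*) {ι : Type*} [CommRing R] [Fintype ι] (i : ι) :
    Subgroup (Heisenberg R ι) where
  carrier := {x | ∀ j, j ≠ i → x.a j = 0 ∧ x.b j = 0}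
  one_mem' _ _ := ⟨rfl, rfl⟩
  mul_mem' hx hy j hj := by simp [hx j hj, hy j hj]
  inv_mem' hx j hj := by simp [hx j hj]

theorem mk_zero_zero_mem_factor (i : ι) (r : R) :
    (⟨0, 0, r⟩ : Heisenberg R ι) ∈ factor R i := fun j hj => by simp

variable [DecidableEq ι]

theorem mk_single_zero_mem_factor (i : ι) (r : R) :
    (⟨Pi.single i r, 0, 0⟩ : Heisenberg R ι) ∈ factor R i := fun j hj => by simp [hj]

theorem mk_zero_single_mem_factor (i : ι) (r : R) :
    (⟨0, Pi.single i r, 0⟩ : Heisenberg R ι) ∈ factor R i := fun j hj => by simp [hj]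

theorem eq_zero_of_forall_mem_factor {i : ι} {x : Heisenberg R ι}
    (h : ∀ y ∈ factor R i, y * x = x * y) : x.a i = 0 ∧ x.b i = 0 := by
  constructor
  · have := (mul_comm_iff _ _).1 (h _ (mk_zero_single_mem_factor i 1))
    simpa using this.symm
  · have := (mul_comm_iff _ _).1 (h _ (mk_single_zero_mem_factor i 1))
    simpa using this

theorem mem_center_iff {x : Heisenberg R ι} :
    x ∈ Subgroup.center (Heisenberg R ι) ↔ x.a = 0 ∧ x.b = 0 := by
  refine ⟨fun h => ?_, fun h => mem_center_of_eq_zero h.1 h.2⟩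
  have := fun i => eq_zero_of_forall_mem_factor (i := i) fun y _ =>
    Subgroup.mem_center_iff.1 h y
  exact ⟨funext fun i => (this i).1, funext fun i => (this i).2⟩

theorem rcomm_single (i : ι) (r : R) :
    rcomm (⟨Pi.single i r, 0, 0⟩ : Heisenberg R ι) ⟨0, Pi.single i 1, 0⟩ = ⟨0, 0, r⟩ := by
  rw [rcomm_eq]
  simp

theorem mk_zero_zero_mem_commutator [Nonempty ι] (r : R) :
    (⟨0, 0, r⟩ : Heisenberg R ι) ∈ commutator (Heisenberg R ι) := by
  obtain ⟨i⟩ := ‹Nonempty ι›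
  rw [← rcomm_single i r]
  exact rcomm_mem_commutator _ _

/-- Commuting with the two unit vectors of `factor R i` already forces both `i`-th coordinates to
vanish; the others vanish by membership. -/
theorem map_center_factor (i : ι) :
    (Subgroup.center (factor R i)).map (factor R i).subtype =
      Subgroup.center (Heisenberg R ι) := by
  ext x
  simp only [Subgroup.mem_map, Subgroup.subtype_apply]
  constructor
  · rintro ⟨x, hx, rfl⟩
    have h0 := eq_zero_of_forall_mem_factor (i := i) (x := x) fun y hy =>
      congrArg Subtype.val (Subgroup.mem_center_iff.1 hx ⟨y, hy⟩)
    refine mem_center_of_eq_zero (funext fun j => ?_) (funext fun j => ?_)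
    · by_cases hj : j = i
      · rw [hj, h0.1, Pi.zero_apply]
      · exact (x.2 j hj).1
    · by_cases hj : j = i
      · rw [hj, h0.2, Pi.zero_apply]
      · exact (x.2 j hj).2
  · intro hx
    have h0 := mem_center_iff.1 hx
    refine ⟨⟨x, fun j _ => by simp [h0]⟩, Subgroup.mem_center_iff.2 fun y => ?_, rfl⟩
    exact Subtype.ext (Subgroup.mem_center_iff.1 hx y)

theorem isFullCentralProduct_factor [Nonempty ι] :
    IsFullCentralProduct (fun i : ι => factor R i) where
  commute i j hij x hx y hy := by
    rw [mul_comm_iff]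
    have h1 : ∀ k, x.a k * y.b k = 0 := fun k => by
      by_cases hk : k = i
      · rw [(hy k (hk.trans_ne hij)).2, mul_zero]
      · rw [(hx k hk).1, zero_mul]
    have h2 : ∀ k, y.a k * x.b k = 0 := fun k => by
      by_cases hk : k = i
      · rw [(hy k (hk.trans_ne hij)).1, zero_mul]
      · rw [(hx k hk).2, mul_zero]
    simp [dotProduct, h1, h2]
  iSup_eq_top := by
    rw [eq_top_iff]
    intro x _
    set S : Subgroup (Heisenberg R ι) := ⨆ i, factor R i
    have hS : ∀ i, factor R i ≤ S := le_iSup _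
    have ha : ∀ s : Finset ι, (⟨∑ i ∈ s, Pi.single i (x.a i), 0, 0⟩ : Heisenberg R ι) ∈ S := by
      intro s
      induction s using Finset.induction_on with
      | empty => exact one_mem S
      | insert i s hi ih =>
        convert mul_mem (hS i (mk_single_zero_mem_factor i (x.a i))) ih using 1
        ext <;> simp [Finset.sum_insert hi]
    have hb : ∀ s : Finset ι, (⟨0, ∑ i ∈ s, Pi.single i (x.b i), 0⟩ : Heisenberg R ι) ∈ S := by
      intro s
      induction s using Finset.induction_on with
      | empty => exact one_mem S
      | insert i s hi ih =>
        convert mul_mem (hS i (mk_zero_single_mem_factor i (x.b i))) ih using 1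
        ext <;> simp [Finset.sum_insert hi]
    obtain ⟨i⟩ := ‹Nonempty ι›
    -- With the `b`-part on the left, the term `x.a ⬝ᵥ y.b` of the product vanishes.
    convert mul_mem (mul_mem (hb Finset.univ) (ha Finset.univ))
      (hS i (mk_zero_zero_mem_factor i x.c)) using 1
    ext <;> simp [Finset.univ_sum_single]
  map_center := map_center_factor

theorem commutator_factor (i : ι) :
    commutator (factor R i) = Subgroup.center (factor R i) := by
  apply le_antisymm
  · rw [commutator_def, Subgroup.commutator_le]
    intro x _ y _
    refine Subgroup.mem_center_iff.2 fun z => Subtype.ext ?_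
    exact Subgroup.mem_center_iff.1 (commutator_le_center (Subgroup.commutator_mem_commutator
      (Subgroup.mem_top (x : Heisenberg R ι)) (Subgroup.mem_top (y : Heisenberg R ι)))) z
  · intro x hx
    have h0 := mem_center_iff.1
      ((map_center_factor (R := R) i).le (Subgroup.mem_map_of_mem _ hx))
    have : x = rcomm (⟨_, mk_single_zero_mem_factor i (x : Heisenberg R ι).c⟩ : factor R i)
        ⟨_, mk_zero_single_mem_factor i 1⟩ := by
      apply Subtype.ext
      refine Eq.trans ?_ (rcomm_single i _).symm
      exact Heisenberg.ext h0.1 h0.2 rfl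
    rw [this]
    exact rcomm_mem_commutator _ _

theorem factor_nonabelian [Nontrivial R] (i : ι) : ∃ x y : factor R i, x * y ≠ y * x := by
  refine ⟨⟨_, mk_single_zero_mem_factor i 1⟩, ⟨_, mk_zero_single_mem_factor i 1⟩, fun h => ?_⟩
  have := (mul_comm_iff _ _).1 (congrArg Subtype.val h)
  simp at this

theorem nilpotencyClass_factor [Nontrivial R] (i : ι) :
    Group.nilpotencyClass (factor R i) = 2 :=
  nilpotencyClass_eq_two (commutator_factor i).le (factor_nonabelian i)

/-- The condition `hR` makes the powers of two unit vectors exhaust both coordinates; their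
commutators supply the central one. -/
theorem rank_factor [Nontrivial R] [Finite R] (hR : ∀ r : R, ∃ k : ℕ, (k : R) = r) (i : ι) :
    Group.rank (factor R i) = 2 := by
  classical
  refine le_antisymm ?_ (two_le_rank_of_nonabelian (factor_nonabelian i))
  let X : factor R i := ⟨_, mk_single_zero_mem_factor i 1⟩
  let Y : factor R i := ⟨_, mk_zero_single_mem_factor i 1⟩
  refine (Group.rank_le (S := {X, Y}) ?_).trans Finset.card_le_two
  rw [eq_top_iff]
  intro x _
  set S := Subgroup.closure ((({X, Y} : Finset (factor R i)) : Set (factor R i)))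
  have hX : X ∈ S := Subgroup.subset_closure (by simp)
  have hY : Y ∈ S := Subgroup.subset_closure (by simp)
  have hXpow : ∀ k : ℕ, ((X ^ k : factor R i) : Heisenberg R ι) = ⟨Pi.single i (k : R), 0, 0⟩ := by
    intro k
    induction k with
    | zero => ext <;> simp
    | succ k ih =>
      rw [pow_succ, Subgroup.coe_mul, ih]
      ext <;> simp [X, Pi.single_add]
  have hYpow : ∀ k : ℕ, ((Y ^ k : factor R i) : Heisenberg R ι) = ⟨0, Pi.single i (k : R), 0⟩ := by
    intro k
    induction k with
    | zero => ext <;> simp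
    | succ k ih =>
      rw [pow_succ, Subgroup.coe_mul, ih]
      ext <;> simp [Y, Pi.single_add]
  obtain ⟨k, hk⟩ := hR ((x : Heisenberg R ι).a i)
  obtain ⟨l, hl⟩ := hR ((x : Heisenberg R ι).b i)
  obtain ⟨t, ht⟩ := hR (x : Heisenberg R ι).c
  have hx : x = Y ^ l * X ^ k * rcomm (X ^ t) Y := by
    apply Subtype.ext
    have h1 : ((rcomm (X ^ t) Y : factor R i) : Heisenberg R ι) =
        rcomm ((X ^ t : factor R i) : Heisenberg R ι) Y := rfl
    rw [Subgroup.coe_mul, Subgroup.coe_mul, h1, hXpow, hYpow, hXpow, rcomm_single, hk, hl, ht]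
    ext j
    · by_cases hj : j = i
      · subst hj; simp
      · simp [hj, (x.2 j hj).1]
    · by_cases hj : j = i
      · subst hj; simp
      · simp [hj, (x.2 j hj).2]
    · simp
  rw [hx]
  refine mul_mem (mul_mem (pow_mem hY _) (pow_mem hX _)) ?_
  exact mul_mem (mul_mem (mul_mem (inv_mem (pow_mem hX _)) (inv_mem hY)) (pow_mem hX _)) hY

/-- The isomorphism of `R` with the commutator subgroup of the Heisenberg group. -/
def commutatorEquiv (R ι : Type*) [CommRing R] [Fintype ι] [DecidableEq ι] [Nonempty ι] :
    Multiplicative R ≃* commutator (Heisenberg R ι) where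
  toFun r := ⟨⟨0, 0, r.toAdd⟩, mk_zero_zero_mem_commutator _⟩
  invFun z := Multiplicative.ofAdd (z : Heisenberg R ι).c
  left_inv _ := rfl
  right_inv z := Subtype.ext <| by
    have h0 := mem_center_iff.1 (commutator_le_center z.2)
    exact Heisenberg.ext h0.1.symm h0.2.symm rfl
  map_mul' r s := Subtype.ext <| by ext <;> simp

end Heisenberg

/-! ### Isoclinism from the commutator pairing. -/

section Isoclinism

open scoped IsMulCommutative

/-- A group of class at most two whose commutator pairing is the standard symplectic form over
`R` is isoclinic to a Heisenberg group. -/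
theorem isoclinic_heisenberg {G : Type*} [Group G] [IsMulCommutative (commutator G)]
    [IsMulCommutative (G ⧸ Subgroup.center G)] (h : commutator G ≤ Subgroup.center G)
    {R ι : Type*} [CommRing R] [Fintype ι] [DecidableEq ι] [Nonempty ι]
    (E : ((ι → R) × (ι → R)) ≃+ Additive (G ⧸ Subgroup.center G))
    (θ : Additive (commutator G) ≃+ R)
    (hE : ∀ u v, θ (commPairing h (E u) (E v)) = u.1 ⬝ᵥ v.2 - v.1 ⬝ᵥ u.2) :
    Isoclinic G (Heisenberg R ι) := by
  let η : Heisenberg R ι →* G ⧸ Subgroup.center G :=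
    MonoidHom.mk' (fun x => (E (x.a, x.b)).toMul) fun x y =>
      congrArg Additive.toMul (E.map_add (x.a, x.b) (y.a, y.b))
  have hη : Function.Surjective η := fun g =>
    ⟨⟨(E.symm (Additive.ofMul g)).1, (E.symm (Additive.ofMul g)).2, 0⟩,
      congrArg Additive.toMul (E.apply_symm_apply (Additive.ofMul g))⟩
  have hker : Subgroup.center (Heisenberg R ι) = η.ker := by
    ext x
    rw [Heisenberg.mem_center_iff, MonoidHom.mem_ker]
    have : η x = 1 ↔ E (x.a, x.b) = 0 := Iff.rfl
    rw [this, map_eq_zero_iff E E.injective, Prod.mk_eq_zero]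
  let ψ : Heisenberg R ι ⧸ Subgroup.center (Heisenberg R ι) ≃* G ⧸ Subgroup.center G :=
    (QuotientGroup.quotientMulEquivOfEq hker).trans
      (QuotientGroup.quotientKerEquivOfSurjective η hη)
  have hψ : ∀ x : Heisenberg R ι, ψ x = η x := fun x => rfl
  let τ : commutator G ≃* commutator (Heisenberg R ι) :=
    (AddEquiv.toMultiplicativeRight θ).trans (Heisenberg.commutatorEquiv R ι)
  refine ⟨ψ.symm, τ, fun x y x' y' hx hy => Subtype.ext ?_⟩
  rw [MulEquiv.symm_apply_eq, hψ] at hx hy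
  have hx' : Additive.ofMul (x : G ⧸ Subgroup.center G) = E (x'.a, x'.b) := hx
  have hy' : Additive.ofMul (y : G ⧸ Subgroup.center G) = E (y'.a, y'.b) := hy
  have := hE (x'.a, x'.b) (y'.a, y'.b)
  rw [← hx', ← hy', commPairing_mk] at this
  refine Eq.trans ?_ (Heisenberg.rcomm_eq x' y').symm
  exact congrArg (Heisenberg.mk 0 0) this

end Isoclinism

/-! ### Assembly of the theorem. -/

section Main

open scoped IsMulCommutative

theorem IsHomocyclic.of_additive_equiv {M : Type*} [Group M] [IsMulCommutative M] {n r : ℕ}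
    (hn : 0 < n) (e : Additive M ≃+ (Fin r → ZMod n)) : IsHomocyclic M :=
  ⟨n, r, hn, ⟨MulEquiv.mk' (e.toEquiv : M ≃ (Fin r → Multiplicative (ZMod n)))
    fun x y => e.map_add (Additive.ofMul x) (Additive.ofMul y)⟩⟩

theorem exists_isoclinic_fullCentralProduct {p k n : ℕ} [Fact p.Prime] {G : Type u} [Group G]
    [IsMulCommutative (commutator G)] [IsMulCommutative (G ⧸ Subgroup.center G)]
    [Nontrivial (Additive (G ⧸ Subgroup.center G))]
    (h : commutator G ≤ Subgroup.center G) (hk : k ≠ 0) (hn : n = p ^ k) {m : ℕ}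
    (E : ((Fin m → ZMod n) × (Fin m → ZMod n)) ≃+ Additive (G ⧸ Subgroup.center G))
    (θ : Additive (commutator G) ≃+ ZMod n)
    (hE : ∀ u v, θ (commPairing h (E u) (E v)) = ∑ i, (u.1 i * v.2 i - u.2 i * v.1 i)) :
    ∃ (H : Type u) (_ : Group H) (_ : Finite H), IsPGroup p H ∧ Isoclinic G H ∧
      ∃ (m : ℕ) (K : Fin m → Subgroup H), 0 < m ∧ IsFullCentralProduct K ∧
        ∀ i, Group.rank (K i) = 2 ∧ Group.nilpotencyClass (K i) = 2 ∧
          commutator (K i) = Subgroup.center (K i) := by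
  have hn1 : 1 < n := hn ▸ Nat.one_lt_pow hk (Fact.out : p.Prime).one_lt
  have : NeZero n := ⟨(zero_lt_one.trans hn1).ne'⟩
  have : Nontrivial (ZMod n) := ZMod.nontrivial_iff.2 hn1.ne'
  have hm : m ≠ 0 := by
    rintro rfl
    exact not_subsingleton _ E.symm.toEquiv.subsingleton
  have : Nonempty (Fin m) := ⟨⟨0, Nat.pos_of_ne_zero hm⟩⟩
  -- Lifted so that the Heisenberg group lives in the universe of `G`.
  let R := ULift.{u} (ZMod n)
  let ρ : R ≃+ ZMod n := ULift.ringEquiv.toAddEquiv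
  let l : (Fin m → R) ≃+ (Fin m → ZMod n) := AddEquiv.piCongrRight fun _ => ρ
  have hiso : Isoclinic G (Heisenberg R (Fin m)) := by
    refine isoclinic_heisenberg h ((l.prodCongr l).trans E) (θ.trans ρ.symm) fun u v => ?_
    rw [AddEquiv.trans_apply, AddEquiv.symm_apply_eq, AddEquiv.trans_apply, AddEquiv.trans_apply,
      hE]
    change _ = ULift.ringEquiv (_ : R)
    simp only [dotProduct, map_sub, map_sum, map_mul, Finset.sum_sub_distrib]
    congr 1
    exact Finset.sum_congr rfl fun i _ => mul_comm _ _
  refine ⟨Heisenberg R (Fin m), inferInstance, inferInstance,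
    Heisenberg.isPGroup (k := k) ?_, hiso, m, fun i => Heisenberg.factor R i,
    Nat.pos_of_ne_zero hm, Heisenberg.isFullCentralProduct_factor,
    fun i => ⟨Heisenberg.rank_factor (fun r => ⟨r.down.val, ?_⟩) i,
      Heisenberg.nilpotencyClass_factor i, Heisenberg.commutator_factor i⟩⟩
  · rw [Nat.card_congr Equiv.ulift, Nat.card_zmod, hn]
  · exact ULift.ext _ _ (ZMod.natCast_zmod_val r.down)

end Main

theorem theoremB (p : ℕ) [Fact p.Prime] (G : Type u) [Group G] [Finite G]
    (hp : IsPGroup p G) (hclass : Group.nilpotencyClass G = 2) (hG : IsCaminaType G) :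
    (Even (Group.rank G) ∧ 2 * Group.rank (commutator G) ≤ Group.rank G) ∧
    IsHomocyclic (G ⧸ Subgroup.center G) ∧
    (IsCyclic (commutator G) →
      ∃ (H : Type u) (_ : Group H) (_ : Finite H), IsPGroup p H ∧ Isoclinic G H ∧
        ∃ (m : ℕ) (K : Fin m → Subgroup H), 0 < m ∧ IsFullCentralProduct K ∧
          ∀ i, Group.rank (K i) = 2 ∧ Group.nilpotencyClass (K i) = 2 ∧
            commutator (K i) = Subgroup.center (K i)) ∧
    HypothesisA G := by
  open scoped IsMulCommutative in
  have : Group.IsNilpotent G := hp.isNilpotent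
  have h := commutator_le_center_of_nilpotencyClass_le_two hclass.le
  have := isMulCommutative_commutator_of_le_center h
  have := isMulCommutative_quotient_center_of_commutator_le h
  have hc := hG.isCaminaPairing hp h
  have hZ := hG.center_le_frattini
  have hA := (hp.to_quotient (Subgroup.center G)).exists_nsmul_eq_zero
  have hW := (hp.to_subgroup (commutator G)).exists_nsmul_eq_zero
  obtain ⟨x, y, hxy⟩ := hG.nonabelian
  have hntW : Nontrivial (Additive (commutator G)) :=
    ⟨Additive.ofMul ⟨rcomm x y, rcomm_mem_commutator x y⟩, 0, fun h0 =>
      hxy (rcomm_eq_one_iff.1 (congrArg Subtype.val h0))⟩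
  have hntA : Nontrivial (Additive (G ⧸ Subgroup.center G)) :=
    ⟨Additive.ofMul (QuotientGroup.mk x), 0, fun h0 =>
      hxy (Subgroup.mem_center_iff.1 ((QuotientGroup.eq_one_iff x).1 h0) y).symm⟩
  obtain ⟨k, hk, hnk⟩ := IsCaminaPairing.exists_exponent_eq hW
  obtain ⟨r, ⟨e⟩⟩ := hc.exists_addEquiv hA
  have hexp := hc.exponent_nsmul_eq_zero
  have hexpW : ∀ w : Additive (commutator G),
      AddMonoid.exponent (Additive (commutator G)) • w = 0 :=
    AddMonoid.exponent_nsmul_eq_zero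
  set n := AddMonoid.exponent (Additive (commutator G)) with hn
  have hpn : p ∣ n := hnk ▸ dvd_pow_self p hk
  have hn0 : 0 < n := hnk ▸ pow_pos (Fact.out : p.Prime).pos k
  have : NeZero n := ⟨hn0.ne'⟩
  have hrank : Group.rank G = r := Group.rank_eq_of_quotient_center hZ hpn e
  obtain ⟨ι, _, q, hq, ⟨eW⟩⟩ := exists_addEquiv_pi_zmod _ hW
  have : ∀ i, NeZero (q i) := fun i => ⟨(zero_lt_one.trans (hq i).1).ne'⟩
  have : Nonempty ι := by
    by_contra hempty
    rw [not_nonempty_iff] at hempty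
    exact not_subsingleton _ eW.toEquiv.subsingleton
  obtain ⟨heven, hle⟩ := hc.even_and_two_mul_card_le hpn e (fun i => (hq i).2) eW
  -- Only `d(γ₂(G)) ≤ |ι|` is needed, since `hle` already bounds `|ι|`.
  have hrankW := Group.rank_le_card_of_additive_equiv eW
  refine ⟨⟨hrank ▸ heven, ?_⟩, .of_additive_equiv hn0 e, fun hcyc => ?_, ?_⟩
  · omega
  · have hcard : Nat.card (Additive (commutator G)) = n := by
      have := isAddCyclic_additive_iff.2 hcyc
      exact IsAddCyclic.exponent_eq_card.symm
    let θ : Additive (commutator G) ≃+ ZMod n :=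
      ((ZMod.ringEquivCongr hcard.symm).toAddEquiv.trans
        (zmodAddCyclicAddEquiv (isAddCyclic_additive_iff.2 hcyc))).symm
    obtain ⟨m, E, hE⟩ := hc.exists_symplectic_addEquiv hk hnk hexp θ
    exact exists_isoclinic_fullCentralProduct h hk hnk E θ hE
  · rw [HypothesisA, hrank, natCard_autC h (hc.mem_range_of_addMonoidHom hA),
      natCard_addMonoidHom_of_addEquiv_pi_zmod e hexpW]
    rfl
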